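/- Let $R$ be a ring and $\mathbf{Mod}_R$ the category of left $R$-modules. An invariant of an abelian category $\mathfrak M$ is a function $h$ from the objects of $\mathfrak M$ to $[0,\infty]$ with $h(0)=0$ and $h(M)=h(N)$ whenever $M\cong N$. If $\mathfrak M$ is a well-powered cocomplete abelian category, an entropy function of $\mathfrak M$ is an invariant $h$ of $\mathfrak M$ such that - for every exact sequence $0\to N\to M\to Q\to 0$ in $\mathfrak M$, $h(M)=0$ if and only if $h(N)=0=h(Q)$; - for every family $(M_j)_{j\in J}$ of objects of $\mathfrak M$ indexed by a set, $h\bigl(\bigoplus_{j\in J}M_j\bigr)=0$ if and only if $h(M_j)=0$ for all $j\in J$. A length function on $\mathbf{Mod}_R$ is an invariant $i$ of $\mathbf{Mod}_R$ such that $i(M)=i(N)+i(M/N)$ for every $R$-module $M$ and submodule $N\le M$, and $i(M)=\sup\{i(F): F\le M \text{ finitely generated}\}$ for every $M$. It is discrete if its finite values lie in a subset of $[0,\infty)$ that is order-isomorphic to $\mathbb N$. A module $M$ is locally $i$-finite if $i(Rx)<\infty$ for every $x\in M$; let $\mathrm{lFin}_i(R)$ be the full subcategory of $\mathbf{Mod}_R$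 of these modules. Let $\mathbf{Flow}_{\mathrm{lFin}_i(R)}$ be the category whose objects are the pairs $(M,\phi)$ with $M\in\mathrm{lFin}_i(R)$ and $\phi\in\mathrm{End}_R(M)$, and whose morphisms $(M,\phi)\to(N,\psi)$ are the homomorphisms $u:M\to N$ with $u\phi=\psi u$; it is a well-powered cocomplete abelian category. For an endomorphism $\phi$ of a module $M$ and a submodule $F\le M$ with $i(F)<\infty$, put $$H_i(\phi,F)=\lim_{n\to\infty}\frac{i\bigl(F+\phi(F)+\cdots+\phi^{n-1}(F)\bigr)}{n}$$ (this limit exists), and let $$\mathrm{ent}_i(\phi)=\sup\{H_i(\phi,F): F\le M,\ i(F)<\infty\}\in[0,\infty].$$ Theorem. Let $i$ be a discrete length function on $\mathbf{Mod}_R$. Then $(M,\phi)\mapsto\mathrm{ent}_i(\phi)$ is an entropy function of $\mathbf{Flow}_{\mathrm{lFin}_i(R)}$. -/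

import Mathlib

open CategoryTheory CategoryTheory.Limits Filter Topology
open scoped ENNReal NNReal

universe u v w

/-! ## Invariants and entropy functions of abelian categories -/

/-- An invariant of a category: a function on objects with values in `[0, ∞]` that
vanishes on zero objects and takes the same value on isomorphic objects. -/
class IsObjectInvariant {C : Type u} [Category.{v} C] (h : C → ℝ≥0∞) : Prop where
  eq_zero_of_isZero : ∀ X : C, IsZero X → h X = 0
  eq_of_iso : ∀ {X Y : C}, (X ≅ Y) → h X = h Y

/-- An entropy function of a well-powered cocomplete abelian category. -/
structure IsEntropyFunction {C : Type u} [Category.{v} C] [Abelian C] [HasColimits C]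
    [WellPowered.{v} C] (h : C → ℝ≥0∞) : Prop where
  /-- `h(0) = 0`, and isomorphic objects have the same value. -/
  isObjectInvariant : IsObjectInvariant h
  /-- For `0 → X₁ → X₂ → X₃ → 0` exact, `h(X₂) = 0` iff `h(X₁) = 0 = h(X₃)`. -/
  eq_zero_iff_of_shortExact : ∀ S : ShortComplex C, S.ShortExact →
    (h S.X₂ = 0 ↔ h S.X₁ = 0 ∧ h S.X₃ = 0)
  /-- A coproduct has value zero iff each of its summands has value zero. -/
  coproduct_eq_zero_iff : ∀ {J : Type v} (M : J → C), h (∐ M) = 0 ↔ ∀ j, h (M j) = 0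

/-! ## Length functions on modules -/

section LengthFunctions

variable {R : Type u} [Ring R]

/-- An additive invariant of the category of left `R`-modules. -/
class IsAdditiveInvariant (i : ModuleCat.{v} R → ℝ≥0∞) : Prop extends IsObjectInvariant i where
  add_quotient : ∀ (M : ModuleCat.{v} R) (N : Submodule R M),
    i M = i (ModuleCat.of R N) + i (ModuleCat.of R (M ⧸ N))

/-- A length function: an upper continuous additive invariant. -/
class IsLengthFunction (i : ModuleCat.{v} R → ℝ≥0∞) : Prop extends IsAdditiveInvariant i where
  upperContinuous : ∀ M : ModuleCat.{v} R,
    i M = ⨆ (F : Submodule R M) (_ : F.FG), i (ModuleCat.of R F)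

/-- An invariant is discrete if its finite values lie in a subset of `[0, ∞)` that is
order-isomorphic to `ℕ`. -/
def IsDiscreteInvariant (i : ModuleCat.{v} R → ℝ≥0∞) : Prop :=
  ∃ S : Set ℝ≥0, Nonempty (S ≃o ℕ) ∧ ∀ M : ModuleCat.{v} R, i M ≠ ∞ → ∃ s ∈ S, i M = s

/-- The trajectory `T_n(φ, F) = F + φ(F) + ⋯ + φ^(n-1)(F)`. -/
def trajectory {M : Type v} [AddCommGroup M] [Module R M] (φ : Module.End R M)
    (F : Submodule R M) (n : ℕ) : Submodule R M :=
  ∑ k ∈ Finset.range n, F.map (φ ^ k)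

/-- `H_i(φ, F) = lim_{n → ∞} i(T_n(φ, F)) / n`. The limit exists when `i` is an additive
invariant and `i(F) < ∞`, see `tendsto_entropyAt`. -/
noncomputable def entropyAt (i : ModuleCat.{v} R → ℝ≥0∞) {M : Type v} [AddCommGroup M]
    [Module R M] (φ : Module.End R M) (F : Submodule R M) : ℝ≥0∞ :=
  limUnder atTop fun n : ℕ => i (ModuleCat.of R (trajectory φ F n)) / (n : ℝ≥0∞)

/-- The `i`-entropy of `φ`: the supremum of `H_i(φ, F)` over the submodules `F` with
`i(F) < ∞`. -/
noncomputable def iEntropy (i : ModuleCat.{v} R → ℝ≥0∞) {M : Type v} [AddCommGroup M]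
    [Module R M] (φ : Module.End R M) : ℝ≥0∞ :=
  ⨆ (F : Submodule R M) (_ : i (ModuleCat.of R F) < ∞), entropyAt i φ F

/-- The property of being locally `i`-finite: `i(Rx) < ∞` for all `x`. -/
def locallyFinite (i : ModuleCat.{v} R → ℝ≥0∞) : ObjectProperty (ModuleCat.{v} R) :=
  fun M => ∀ x : M, i (ModuleCat.of R (Submodule.span R {x})) < ∞

theorem IsAdditiveInvariant.eq_of_equiv (i : ModuleCat.{v} R → ℝ≥0∞) [IsAdditiveInvariant i]
    {M N : Type v} [AddCommGroup M] [Module R M] [AddCommGroup N] [Module R N] (e : M ≃ₗ[R] N) :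
    i (ModuleCat.of R M) = i (ModuleCat.of R N) :=
  IsObjectInvariant.eq_of_iso e.toModuleIso

theorem IsAdditiveInvariant.submodule_le (i : ModuleCat.{v} R → ℝ≥0∞) [IsAdditiveInvariant i]
    {M : Type v} [AddCommGroup M] [Module R M] (P : Submodule R M) :
    i (ModuleCat.of R P) ≤ i (ModuleCat.of R M) := by
  rw [IsAdditiveInvariant.add_quotient (i := i) (ModuleCat.of R M) P]
  exact le_self_add

theorem IsAdditiveInvariant.le_of_injective (i : ModuleCat.{v} R → ℝ≥0∞) [IsAdditiveInvariant i]
    {M N : Type v} [AddCommGroup M] [Module R M] [AddCommGroup N] [Module R N] (f : M →ₗ[R] N)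
    (hf : Function.Injective f) : i (ModuleCat.of R M) ≤ i (ModuleCat.of R N) :=
  (eq_of_equiv i (LinearEquiv.ofInjective f hf)).trans_le (submodule_le i _)

theorem IsAdditiveInvariant.le_of_surjective (i : ModuleCat.{v} R → ℝ≥0∞) [IsAdditiveInvariant i]
    {M N : Type v} [AddCommGroup M] [Module R M] [AddCommGroup N] [Module R N] (f : M →ₗ[R] N)
    (hf : Function.Surjective f) : i (ModuleCat.of R N) ≤ i (ModuleCat.of R M) := by
  rw [IsAdditiveInvariant.add_quotient (i := i) (ModuleCat.of R M) (LinearMap.ker f),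
    ← eq_of_equiv i (f.quotKerEquivOfSurjective hf)]
  exact le_add_self

theorem IsAdditiveInvariant.prod_le (i : ModuleCat.{v} R → ℝ≥0∞) [IsAdditiveInvariant i]
    {M N : Type v} [AddCommGroup M] [Module R M] [AddCommGroup N] [Module R N] :
    i (ModuleCat.of R (M × N)) ≤ i (ModuleCat.of R M) + i (ModuleCat.of R N) := by
  rw [IsAdditiveInvariant.add_quotient (i := i) (ModuleCat.of R (M × N))
    (LinearMap.ker (LinearMap.snd R M N))]
  refine add_le_add (le_of_injective i ((LinearMap.fst R M N).comp (Submodule.subtype _)) ?_)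
    (eq_of_equiv i ((LinearMap.snd R M N).quotKerEquivOfSurjective
      LinearMap.snd_surjective)).le
  rintro ⟨⟨a, b⟩, hab⟩ ⟨⟨c, d⟩, hcd⟩ h
  rw [LinearMap.mem_ker] at hab hcd
  simp_all

theorem IsAdditiveInvariant.mono (i : ModuleCat.{v} R → ℝ≥0∞) [IsAdditiveInvariant i]
    {M : Type v} [AddCommGroup M] [Module R M] {P Q : Submodule R M} (h : P ≤ Q) :
    i (ModuleCat.of R P) ≤ i (ModuleCat.of R Q) :=
  le_of_injective i (Submodule.inclusion h) (Submodule.inclusion_injective h)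

theorem IsAdditiveInvariant.map_le (i : ModuleCat.{v} R → ℝ≥0∞) [IsAdditiveInvariant i]
    {M N : Type v} [AddCommGroup M] [Module R M] [AddCommGroup N] [Module R N] (f : M →ₗ[R] N)
    (P : Submodule R M) : i (ModuleCat.of R (P.map f)) ≤ i (ModuleCat.of R P) :=
  le_of_surjective i (f.submoduleMap P) (f.submoduleMap_surjective P)

theorem IsAdditiveInvariant.sup_le (i : ModuleCat.{v} R → ℝ≥0∞) [IsAdditiveInvariant i]
    {M : Type v} [AddCommGroup M] [Module R M] (P Q : Submodule R M) :
    i (ModuleCat.of R (P ⊔ Q : Submodule R M)) ≤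
      i (ModuleCat.of R P) + i (ModuleCat.of R Q) := by
  refine le_trans ?_ (prod_le i)
  refine le_of_surjective i ((Submodule.inclusion le_sup_left).coprod
    (Submodule.inclusion (le_sup_right : Q ≤ P ⊔ Q))) ?_
  rintro ⟨x, hx⟩
  obtain ⟨y, hy, z, hz, rfl⟩ := Submodule.mem_sup.1 hx
  exact ⟨(⟨y, hy⟩, ⟨z, hz⟩), by ext; simp⟩

theorem trajectory_add {M : Type v} [AddCommGroup M] [Module R M] (φ : Module.End R M)
    (F : Submodule R M) (m n : ℕ) :
    trajectory φ F (m + n) = trajectory φ F m ⊔ (trajectory φ F n).map (φ ^ m) := by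
  induction n with
  | zero => simp [trajectory]
  | succ n ih =>
    have h : trajectory φ F (n + 1) = trajectory φ F n ⊔ F.map (φ ^ n) := by
      simp [trajectory, Finset.sum_range_succ]
    have h' : trajectory φ F (m + (n + 1)) = trajectory φ F (m + n) ⊔ F.map (φ ^ (m + n)) := by
      rw [← add_assoc]
      simp [trajectory, Finset.sum_range_succ]
    rw [h, h', ih, Submodule.map_sup, sup_assoc, pow_add, Module.End.mul_eq_comp,
      Submodule.map_comp]

theorem trajectory_ne_top (i : ModuleCat.{v} R → ℝ≥0∞) [IsAdditiveInvariant i] {M : Type v}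
    [AddCommGroup M] [Module R M] (φ : Module.End R M) (F : Submodule R M)
    (hF : i (ModuleCat.of R F) < ∞) (n : ℕ) : i (ModuleCat.of R (trajectory φ F n)) ≠ ∞ := by
  induction n with
  | zero =>
    have h : trajectory φ F 0 ≤ F := by simp [trajectory]
    exact ((IsAdditiveInvariant.mono i h).trans_lt hF).ne
  | succ n ih =>
    have h : trajectory φ F (n + 1) = trajectory φ F n ⊔ F.map (φ ^ n) := by
      simp [trajectory, Finset.sum_range_succ]
    rw [h]
    exact ((IsAdditiveInvariant.sup_le i _ _).trans_lt (ENNReal.add_lt_top.2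
      ⟨ih.lt_top, (IsAdditiveInvariant.map_le i _ _).trans_lt hF⟩)).ne

/-- The limit defining `H_i(φ, F)` exists and is finite when `i(F) < ∞`. -/
theorem tendsto_entropyAt (i : ModuleCat.{v} R → ℝ≥0∞) [IsAdditiveInvariant i] {M : Type v}
    [AddCommGroup M] [Module R M] (φ : Module.End R M) (F : Submodule R M)
    (hF : i (ModuleCat.of R F) < ∞) :
    Tendsto (fun n : ℕ => i (ModuleCat.of R (trajectory φ F n)) / (n : ℝ≥0∞)) atTop
      (𝓝 (entropyAt i φ F)) ∧ entropyAt i φ F < ∞ := by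
  have hfin := trajectory_ne_top i φ F hF
  have hsub : Subadditive fun n => (i (ModuleCat.of R (trajectory φ F n))).toReal := by
    intro m n
    rw [← ENNReal.toReal_add (hfin m) (hfin n)]
    refine ENNReal.toReal_mono (ENNReal.add_ne_top.2 ⟨hfin m, hfin n⟩) ?_
    rw [trajectory_add]
    exact (IsAdditiveInvariant.sup_le i _ _).trans
      (add_le_add_right (IsAdditiveInvariant.map_le i _ _) _)
  have hlim := hsub.tendsto_lim ⟨0, by rintro _ ⟨n, rfl⟩; positivity⟩
  have hE := ENNReal.tendsto_ofReal hlim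
  have key : Tendsto (fun n : ℕ => i (ModuleCat.of R (trajectory φ F n)) / (n : ℝ≥0∞)) atTop
      (𝓝 (ENNReal.ofReal hsub.lim)) := by
    refine hE.congr' ?_
    filter_upwards [eventually_gt_atTop 0] with n hn
    rw [ENNReal.ofReal_div_of_pos (by exact_mod_cast hn), ENNReal.ofReal_toReal (hfin n),
      ENNReal.ofReal_natCast]
  have h : entropyAt i φ F = ENNReal.ofReal hsub.lim := key.limUnder_eq
  rw [h]
  exact ⟨key, ENNReal.ofReal_lt_top⟩

/-- The submodule `f_i(M)` of those `x` with `i(Rx) < ∞`. -/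
def finitePart (i : ModuleCat.{v} R → ℝ≥0∞) [IsAdditiveInvariant i] (M : Type v)
    [AddCommGroup M] [Module R M] : Submodule R M where
  carrier := {x | i (ModuleCat.of R (Submodule.span R {x})) < ∞}
  zero_mem' := by
    have h : i (ModuleCat.of R (Submodule.span R {(0 : M)})) = 0 := by
      refine IsObjectInvariant.eq_zero_of_isZero _ (@ModuleCat.isZero_of_subsingleton _ _ _ ?_)
      rw [Submodule.span_zero_singleton]
      exact inferInstanceAs (Subsingleton (⊥ : Submodule R M))
    simp [h]
  add_mem' := by
    intro a b ha hb
    have h : Submodule.span R {a + b} ≤ Submodule.span R {a} ⊔ Submodule.span R {b} := by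
      rw [Submodule.span_singleton_le_iff_mem]
      exact Submodule.add_mem_sup (Submodule.mem_span_singleton_self a)
        (Submodule.mem_span_singleton_self b)
    exact ((IsAdditiveInvariant.mono i h).trans (IsAdditiveInvariant.sup_le i _ _)).trans_lt
      (ENNReal.add_lt_top.2 ⟨ha, hb⟩)
  smul_mem' := by
    intro r x hx
    exact (IsAdditiveInvariant.mono i (Submodule.span_singleton_smul_le R r x)).trans_lt hx

theorem map_mem_finitePart (i : ModuleCat.{v} R → ℝ≥0∞) [IsAdditiveInvariant i]
    {M N : Type v} [AddCommGroup M] [Module R M] [AddCommGroup N] [Module R N] (f : M →ₗ[R] N)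
    {x : M} (hx : i (ModuleCat.of R (Submodule.span R {x})) < ∞) : f x ∈ finitePart i N := by
  have h : (Submodule.span R {x}).map f = Submodule.span R {f x} := by
    rw [Submodule.map_span, Set.image_singleton]
  change i (ModuleCat.of R (Submodule.span R {f x})) < ∞
  rw [← h]
  exact (IsAdditiveInvariant.map_le i f _).trans_lt hx

/-! The category of locally `i`-finite modules is a well-powered cocomplete abelian category. -/

instance (i : ModuleCat.{v} R → ℝ≥0∞) [IsAdditiveInvariant i] :
    (locallyFinite i).IsClosedUnderQuotients where
  prop_of_epi {X Y} f _ hX y := by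
    obtain ⟨x, rfl⟩ := (ModuleCat.epi_iff_surjective f).1 inferInstance y
    exact map_mem_finitePart i f.hom (hX x)

instance (i : ModuleCat.{v} R → ℝ≥0∞) [IsAdditiveInvariant i] :
    (locallyFinite i).IsClosedUnderSubobjects where
  prop_of_mono {X Y} f _ hY x := by
    have hf := (ModuleCat.mono_iff_injective f).1 inferInstance
    have h : (Submodule.span R {x}).map f.hom = Submodule.span R {f.hom x} := by
      rw [Submodule.map_span, Set.image_singleton]
    have e := IsAdditiveInvariant.eq_of_equiv i
      (Submodule.equivMapOfInjective f.hom hf (Submodule.span R {x}))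
    rw [e, h]
    exact hY _

instance (i : ModuleCat.{v} R → ℝ≥0∞) [IsAdditiveInvariant i] {J : Type w} [Category.{w} J] :
    (locallyFinite i).IsClosedUnderColimitsOfShape J where
  colimitsOfShape_le := by
    rintro X ⟨⟨⟨F, ι, hc⟩, hF⟩⟩
    have hq : ModuleCat.ofHom (finitePart i X).mkQ = 0 := by
      refine hc.hom_ext fun j => ?_
      ext x
      simpa using map_mem_finitePart i (ι.app j).hom (hF j x)
    intro x
    have hx : (finitePart i X).mkQ x = 0 := by
      have := congrArg (fun g => g.hom x) hq
      simpa using this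
    exact (Submodule.Quotient.mk_eq_zero _).1 hx

instance (i : ModuleCat.{v} R → ℝ≥0∞) [IsAdditiveInvariant i] :
    (locallyFinite i).ContainsZero where
  exists_zero := ⟨ModuleCat.of R PUnit, ModuleCat.isZero_of_subsingleton _, fun x => by
    rw [Subsingleton.elim x 0]
    exact (finitePart i PUnit).zero_mem⟩

instance (i : ModuleCat.{v} R → ℝ≥0∞) [IsAdditiveInvariant i] :
    (locallyFinite i).IsClosedUnderFiniteProducts := by
  have : (locallyFinite i).IsClosedUnderBinaryProducts := ⟨by
    rintro X ⟨⟨⟨F, π, hl⟩, hF⟩⟩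
    have hb := (locallyFinite i).prop_of_isColimit_binaryCofan
      (BinaryBiproduct.isColimit (F.obj ⟨.left⟩) (F.obj ⟨.right⟩)) (hF _) (hF _)
    refine (locallyFinite i).prop_of_iso ?_ hb
    exact (BinaryBiproduct.isLimit _ _).conePointsIsoOfNatIso hl (diagramIsoPair F).symm⟩
  exact .mk'

noncomputable instance (i : ModuleCat.{v} R → ℝ≥0∞) [IsAdditiveInvariant i] :
    Abelian (locallyFinite i).FullSubcategory := inferInstance

instance (i : ModuleCat.{v} R → ℝ≥0∞) [IsAdditiveInvariant i] :
    HasColimits (locallyFinite i).FullSubcategory where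
  has_colimits_of_shape _ _ := inferInstance

end LengthFunctions

/-! ## Flows -/

/-- A flow in a category `C`: an object with an endomorphism. -/
structure FlowCat (C : Type u) [Category.{v} C] where
  obj : C
  endo : obj ⟶ obj

namespace FlowCat

variable {C : Type u} [Category.{v} C]

/-- A morphism of flows: a morphism of objects commuting with the endomorphisms. -/
@[ext]
structure Hom (X Y : FlowCat C) where
  hom : X.obj ⟶ Y.obj
  comm : X.endo ≫ hom = hom ≫ Y.endo

instance : Category.{v} (FlowCat C) where
  Hom X Y := Hom X Y
  id X := ⟨𝟙 X.obj, by simp⟩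
  comp f g := ⟨f.hom ≫ g.hom, by rw [← Category.assoc, f.comm, Category.assoc, g.comm,
    Category.assoc]⟩

@[ext]
theorem hom_ext {X Y : FlowCat C} {f g : X ⟶ Y} (h : f.hom = g.hom) : f = g := Hom.ext h

@[simp]
theorem id_hom (X : FlowCat C) : (𝟙 X : X ⟶ X).hom = 𝟙 X.obj := rfl

@[simp]
theorem comp_hom {X Y Z : FlowCat C} (f : X ⟶ Y) (g : Y ⟶ Z) :
    (f ≫ g).hom = f.hom ≫ g.hom := rfl

/-- The functor `(X, φ) ↦ X`. -/
@[simps]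
def forget (C : Type u) [Category.{v} C] : FlowCat C ⥤ C where
  obj X := X.obj
  map f := f.hom

theorem endo_pow_comm {X Y : FlowCat C} (f : X ⟶ Y) (n : ℕ) :
    ((show End X.obj from X.endo) ^ n : End X.obj) ≫ f.hom =
      f.hom ≫ ((show End Y.obj from Y.endo) ^ n : End Y.obj) := by
  induction n with
  | zero => simp [End.one_def]
  | succ n ih =>
    rw [pow_succ', pow_succ', End.mul_def, End.mul_def, Category.assoc, ← Category.assoc f.hom,
      ← ih, Category.assoc]
    congr 1
    exact f.comm

/-- Flows are the same as actions of the free monoid on one generator. -/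
def toAction (C : Type u) [Category.{v} C] : FlowCat C ⥤ Action C (Multiplicative ℕ) where
  obj X := ⟨X.obj, powersHom (End X.obj) X.endo⟩
  map f := ⟨f.hom, fun g => endo_pow_comm f g.toAdd⟩

instance : (toAction C).Faithful where
  map_injective h := hom_ext (congrArg Action.Hom.hom h)

instance : (toAction C).Full where
  map_surjective {X Y} g := by
    have h := g.comm (.ofAdd 1)
    refine ⟨⟨g.hom, ?_⟩, rfl⟩
    have hX : powersHom (End X.obj) X.endo (.ofAdd 1) = X.endo := by simp
    have hY : powersHom (End Y.obj) Y.endo (.ofAdd 1) = Y.endo := by simp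
    change powersHom (End X.obj) X.endo (.ofAdd 1) ≫ g.hom =
      g.hom ≫ powersHom (End Y.obj) Y.endo (.ofAdd 1) at h
    rwa [hX, hY] at h

instance : (toAction C).EssSurj where
  mem_essImage A := by
    refine ⟨⟨A.V, A.ρ (.ofAdd 1)⟩, ⟨Action.mkIso (Iso.refl _) fun g => ?_⟩⟩
    have h : powersHom (End A.V) (A.ρ (.ofAdd 1)) = A.ρ := by
      ext
      simp
    have h' := DFunLike.congr_fun h g
    simp only [Iso.refl_hom]
    erw [Category.comp_id, Category.id_comp]
    exact h'

instance : (toAction C).IsEquivalence where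

instance [HasColimits C] : HasColimits (FlowCat C) :=
  Adjunction.has_colimits_of_equivalence (toAction C)

section Preadditive

variable [Preadditive C]

instance (X Y : FlowCat C) : Zero (X ⟶ Y) := ⟨⟨0, by simp⟩⟩
instance (X Y : FlowCat C) : Add (X ⟶ Y) := ⟨fun f g => ⟨f.hom + g.hom, by simp [f.comm, g.comm]⟩⟩
instance (X Y : FlowCat C) : Neg (X ⟶ Y) := ⟨fun f => ⟨-f.hom, by simp [f.comm]⟩⟩
instance (X Y : FlowCat C) : Sub (X ⟶ Y) := ⟨fun f g => ⟨f.hom - g.hom, by simp [f.comm, g.comm]⟩⟩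
instance (X Y : FlowCat C) : SMul ℕ (X ⟶ Y) := ⟨fun n f => ⟨n • f.hom, by simp [f.comm]⟩⟩
instance (X Y : FlowCat C) : SMul ℤ (X ⟶ Y) := ⟨fun n f => ⟨n • f.hom, by simp [f.comm]⟩⟩

instance : Preadditive (FlowCat C) where
  homGroup X Y := Function.Injective.addCommGroup (fun f : X ⟶ Y => f.hom) (fun _ _ => hom_ext)
    rfl (fun _ _ => rfl) (fun _ => rfl) (fun _ _ => rfl) (fun _ _ => rfl) (fun _ _ => rfl)
  add_comp _ _ _ _ _ _ := hom_ext (Preadditive.add_comp _ _ _ _ _ _)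
  comp_add _ _ _ _ _ _ := hom_ext (Preadditive.comp_add _ _ _ _ _ _)

instance : (forget C).Additive where

instance : (toAction C).Additive where

end Preadditive

noncomputable instance [Abelian C] : Abelian (FlowCat C) :=
  have : HasFiniteProducts (FlowCat C) :=
    ⟨fun _ => Adjunction.hasLimitsOfShape_of_equivalence (toAction C)⟩
  abelianOfEquivalence (toAction C)

end FlowCat

/-! ### Well-poweredness -/

theorem wellPowered_of_functor {C : Type u} [Category.{v} C] {D : Type w} [Category.{v} D]
    [WellPowered.{v} D] (F : C ⥤ D) [F.Faithful] [F.PreservesMonomorphisms]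
    (hF : ∀ {A B X : C} (f : A ⟶ X) (g : B ⟶ X) [Mono f] [Mono g] (k : F.obj A ⟶ F.obj B),
      k ≫ F.map g = F.map f → ∃ l : A ⟶ B, F.map l = k) : WellPowered.{v} C where
  subobject_small X := by
    refine small_of_injective (f := fun P : Subobject X => Subobject.mk (F.map P.arrow)) ?_
    have key : ∀ P Q : Subobject X,
        Subobject.mk (F.map P.arrow) ≤ Subobject.mk (F.map Q.arrow) → P ≤ Q := by
      intro P Q h
      obtain ⟨l, hl⟩ := hF P.arrow Q.arrow (Subobject.ofMkLEMk _ _ h) (by simp)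
      refine Subobject.le_of_comm l (F.map_injective ?_)
      rw [F.map_comp, hl, Subobject.ofMkLEMk_comp]
    intro P Q h
    exact le_antisymm (key P Q (le_of_eq h)) (key Q P (le_of_eq h.symm))

instance {C : Type u} [Category.{v} C] [Abelian C] [WellPowered.{v} C] :
    WellPowered.{v} (FlowCat C) := by
  have : (FlowCat.forget C).PreservesMonomorphisms :=
    inferInstanceAs (FlowCat.toAction C ⋙ Action.forget C _).PreservesMonomorphisms
  have : (FlowCat.forget C).Faithful := ⟨FlowCat.hom_ext⟩
  refine wellPowered_of_functor (FlowCat.forget C) fun {A B X} f g _ _ k hk => ?_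
  have : Mono g.hom := inferInstanceAs (Mono ((FlowCat.forget C).map g))
  change A.obj ⟶ B.obj at k
  change k ≫ g.hom = f.hom at hk
  refine ⟨⟨k, ?_⟩, rfl⟩
  rw [← cancel_mono g.hom, Category.assoc, hk, f.comm, Category.assoc, g.comm,
    ← Category.assoc k, hk]

instance {R : Type u} [Ring R] (i : ModuleCat.{v} R → ℝ≥0∞) [IsAdditiveInvariant i] :
    WellPowered.{v} (locallyFinite i).FullSubcategory := by
  have := (locallyFinite i).preservesMonomorphisms_ι_of_isNormalEpiCategory
  exact wellPowered_of_functor (locallyFinite i).ι fun _ _ _ _ k _ => ⟨ObjectProperty.homMk k, rfl⟩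

/-! ### The `i`-entropy on flows of locally `i`-finite modules -/

/-- The restriction of the `i`-entropy to flows of locally `i`-finite modules. -/
noncomputable def iEntropyFlow {R : Type u} [Ring R] (i : ModuleCat.{v} R → ℝ≥0∞) :
    FlowCat (locallyFinite i).FullSubcategory → ℝ≥0∞ :=
  fun X => iEntropy i (M := X.obj.obj) X.endo.hom.hom

/-!
Write `T_n(F)` for the `n`-th trajectory of `F` under `φ`. Discreteness is used only through a gap:
some `ε > 0` bounds all nonzero values of `i` from below
(`IsDiscreteInvariant.exists_isLengthGap`).

If every inclusion `T_n(F) ≤ T_{n+1}(F)` adds length, each adds at least `ε`, so `H_i(φ, F) ≥ ε`.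
If one of them adds no length, no later one does, since `T_{n+1}(F) = F + φ(T_n(F))`
(`length_trajectory_le_of_succ_le`). So `H_i(φ, F) = 0` if and only if the lengths of the `T_n(F)`
are bounded (`entropyAt_eq_zero_iff`). The gap and upper continuity also show that a submodule of
finite length is, up to a part of length zero, finitely generated; hence on locally `i`-finite
modules `ent_i(φ) = 0` if and only if every element generates a bounded trajectory
(`iEntropy_eq_zero_iff`).

The elements with bounded trajectories form an invariant submodule, compatible with morphisms of
flows, which gives the claims on subobjects, quotients and coproducts. For an extension
`0 → N → M → Q → 0` and `x : M`, the lengths of the images of `T_n(Rx)` in `Q` become stationary at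
some `n`. Let `P ≤ N` be the invariant submodule generated by `T_{n+1}(Rx) ∩ N`. It has finite
length because the entropy of `N` vanishes, and modulo `P` the trajectory of `x` adds no length
after step `n`; so the trajectory of `x` is bounded (`mem_boundedPart_of_extension`).

Monomorphisms and epimorphisms of flows are shown to be injective and surjective by testing them
against the subflow on the kernel and the quotient flow modulo the range.
-/

/-! ### Additive invariants on lattices of submodules -/

section Modules

variable {R : Type u} [Ring R]

namespace IsAdditiveInvariant

variable (i : ModuleCat.{v} R → ℝ≥0∞) [IsAdditiveInvariant i]
  {M N : Type v} [AddCommGroup M] [Module R M] [AddCommGroup N] [Module R N]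

theorem eq_inf_ker_add_map (f : M →ₗ[R] N) (P : Submodule R M) :
    i (ModuleCat.of R P) =
      i (ModuleCat.of R (P ⊓ LinearMap.ker f : Submodule R M)) +
        i (ModuleCat.of R (P.map f)) := by
  have e₁ : i (ModuleCat.of R (LinearMap.ker (f.domRestrict P))) =
      i (ModuleCat.of R (P ⊓ LinearMap.ker f : Submodule R M)) := by
    have h : (LinearMap.ker (f.domRestrict P)).map P.subtype = P ⊓ LinearMap.ker f := by
      rw [LinearMap.ker_domRestrict]
      exact Submodule.map_comap_subtype P _
    rw [eq_of_equiv i (Submodule.equivMapOfInjective P.subtype P.injective_subtype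
      (LinearMap.ker (f.domRestrict P))), h]
  have e₂ : i (ModuleCat.of R (P ⧸ LinearMap.ker (f.domRestrict P))) =
      i (ModuleCat.of R (P.map f)) := by
    rw [eq_of_equiv i (f.domRestrict P).quotKerEquivRange, LinearMap.range_domRestrict]
  rw [IsAdditiveInvariant.add_quotient (i := i) (ModuleCat.of R P)
    (LinearMap.ker (f.domRestrict P)), ← e₁, ← e₂]

theorem map_eq_of_injective (f : M →ₗ[R] N) (hf : Function.Injective f) (P : Submodule R M) :
    i (ModuleCat.of R (P.map f)) = i (ModuleCat.of R P) :=
  (eq_of_equiv i (Submodule.equivMapOfInjective f hf P)).symm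

theorem sup_add_inf (A B : Submodule R M) :
    i (ModuleCat.of R (A ⊔ B : Submodule R M)) + i (ModuleCat.of R (A ⊓ B : Submodule R M)) =
      i (ModuleCat.of R A) + i (ModuleCat.of R B) := by
  have h₁ := eq_inf_ker_add_map i A.mkQ (A ⊔ B)
  have h₂ := eq_inf_ker_add_map i A.mkQ B
  have h₃ : (A ⊔ B).map A.mkQ = B.map A.mkQ := by
    rw [Submodule.map_sup, Submodule.mkQ_map_self, bot_sup_eq]
  rw [Submodule.ker_mkQ, inf_eq_right.2 le_sup_left, h₃] at h₁
  rw [Submodule.ker_mkQ, inf_comm] at h₂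
  rw [h₁, h₂, add_assoc, add_comm (i _) (i (ModuleCat.of R (A ⊓ B : Submodule R M)))]

variable {i}

/-- Enlarging a submodule by a part of length zero does not enlarge its images. -/
theorem map_le_map (f : M →ₗ[R] N) {A A' : Submodule R M} (h : A ≤ A')
    (hA : i (ModuleCat.of R A') ≤ i (ModuleCat.of R A)) (hfin : i (ModuleCat.of R A') < ∞) :
    i (ModuleCat.of R (A'.map f)) ≤ i (ModuleCat.of R (A.map f)) := by
  have hk := mono i (inf_le_inf_right (LinearMap.ker f) h)
  have hk' : i (ModuleCat.of R (A' ⊓ LinearMap.ker f : Submodule R M)) ≠ ∞ :=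
    ((mono i inf_le_left).trans_lt hfin).ne
  rw [eq_inf_ker_add_map i f A', eq_inf_ker_add_map i f A] at hA
  exact (ENNReal.add_le_add_iff_left hk').1 (hA.trans (add_le_add_left hk _))

/-- Enlarging a submodule by a part of length zero does not enlarge its sums with others. -/
theorem sup_le_sup_left {A A' : Submodule R M} (h : A ≤ A') (B : Submodule R M)
    (hA : i (ModuleCat.of R A') ≤ i (ModuleCat.of R A)) (hfin : i (ModuleCat.of R A') < ∞) :
    i (ModuleCat.of R (A' ⊔ B : Submodule R M)) ≤
      i (ModuleCat.of R (A ⊔ B : Submodule R M)) := by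
  have h₁ := sup_add_inf i A' (A ⊔ B)
  rw [← sup_assoc, sup_eq_left.2 h] at h₁
  have h₂ : i (ModuleCat.of R A) ≤ i (ModuleCat.of R (A' ⊓ (A ⊔ B) : Submodule R M)) :=
    mono i (le_inf h le_sup_left)
  have hfin' : i (ModuleCat.of R A) ≠ ∞ := ((mono i h).trans_lt hfin).ne
  refine (ENNReal.add_le_add_iff_right hfin').1 ?_
  calc _ ≤ i (ModuleCat.of R A') + i (ModuleCat.of R (A ⊔ B : Submodule R M)) :=
        (add_le_add_right h₂ _).trans h₁.le
    _ ≤ _ := by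
        rw [add_comm]
        exact add_le_add_right hA _

end IsAdditiveInvariant

/-! ### Trajectories -/

section Trajectory

variable {M N : Type v} [AddCommGroup M] [Module R M] [AddCommGroup N] [Module R N]

theorem trajectory_zero (φ : Module.End R M) (F : Submodule R M) : trajectory φ F 0 = ⊥ := by
  simp [trajectory]

theorem trajectory_succ (φ : Module.End R M) (F : Submodule R M) (n : ℕ) :
    trajectory φ F (n + 1) = F ⊔ (trajectory φ F n).map φ := by
  have h : trajectory φ F 1 = F := by
    simp [trajectory, Module.End.one_eq_id]
  rw [add_comm, trajectory_add, h, pow_one]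

theorem trajectory_monotone (φ : Module.End R M) (F : Submodule R M) :
    Monotone (trajectory φ F) := by
  refine monotone_nat_of_le_succ fun n => ?_
  rw [trajectory_add]
  exact le_sup_left

theorem trajectory_mono (φ : Module.End R M) {F G : Submodule R M} (h : F ≤ G) (n : ℕ) :
    trajectory φ F n ≤ trajectory φ G n := by
  induction n with
  | zero => simp [trajectory_zero]
  | succ n ih =>
    rw [trajectory_succ, trajectory_succ]
    exact sup_le_sup h (Submodule.map_mono ih)

theorem trajectory_sup (φ : Module.End R M) (F G : Submodule R M) (n : ℕ) :
    trajectory φ (F ⊔ G) n = trajectory φ F n ⊔ trajectory φ G n := by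
  induction n with
  | zero => simp [trajectory_zero]
  | succ n ih =>
    rw [trajectory_succ, trajectory_succ, trajectory_succ, ih, Submodule.map_sup,
      sup_sup_sup_comm]

theorem map_trajectory {φ : Module.End R M} {ψ : Module.End R N} {f : M →ₗ[R] N}
    (hf : ∀ x, f (φ x) = ψ (f x)) (F : Submodule R M) (n : ℕ) :
    (trajectory φ F n).map f = trajectory ψ (F.map f) n := by
  have h : f ∘ₗ φ = ψ ∘ₗ f := LinearMap.ext hf
  induction n with
  | zero => simp [trajectory_zero]
  | succ n ih =>
    rw [trajectory_succ, trajectory_succ, Submodule.map_sup, ← ih, ← Submodule.map_comp,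
      ← Submodule.map_comp, h]

theorem le_iSup_trajectory (φ : Module.End R M) (F : Submodule R M) :
    F ≤ ⨆ n, trajectory φ F n := by
  refine le_trans ?_ (le_iSup _ 1)
  rw [trajectory_succ]
  exact le_sup_left

theorem iSup_trajectory_le_comap (φ : Module.End R M) (F : Submodule R M) :
    ⨆ n, trajectory φ F n ≤ (⨆ n, trajectory φ F n).comap φ := by
  refine iSup_le fun n => Submodule.map_le_iff_le_comap.1 (le_trans ?_ (le_iSup _ (n + 1)))
  rw [trajectory_succ]
  exact le_sup_right

theorem trajectory_le {φ : Module.End R M} {F N : Submodule R M} (hF : F ≤ N)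
    (hN : N ≤ N.comap φ) (n : ℕ) : trajectory φ F n ≤ N := by
  induction n with
  | zero => simp [trajectory_zero]
  | succ n ih =>
    rw [trajectory_succ]
    exact sup_le hF (Submodule.map_le_iff_le_comap.2 (ih.trans hN))

variable {i : ModuleCat.{v} R → ℝ≥0∞} [IsAdditiveInvariant i]

/-- Enlarging `F` by a part of length zero enlarges its trajectories by parts of length zero. -/
theorem length_trajectory_le_of_le {φ : Module.End R M} {F G : Submodule R M} (h : G ≤ F)
    (hi : i (ModuleCat.of R F) ≤ i (ModuleCat.of R G)) (hfin : i (ModuleCat.of R F) < ∞)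
    (n : ℕ) :
    i (ModuleCat.of R (trajectory φ F n)) ≤ i (ModuleCat.of R (trajectory φ G n)) := by
  induction n with
  | zero => rw [trajectory_zero, trajectory_zero]
  | succ n ih =>
    have hT := trajectory_ne_top i φ F hfin n
    rw [trajectory_succ, trajectory_succ]
    refine (IsAdditiveInvariant.sup_le_sup_left h _ hi hfin).trans ?_
    rw [sup_comm G, sup_comm G]
    exact IsAdditiveInvariant.sup_le_sup_left (Submodule.map_mono (trajectory_mono φ h n)) _
      (IsAdditiveInvariant.map_le_map φ (trajectory_mono φ h n) ih hT.lt_top)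
      ((IsAdditiveInvariant.map_le i φ _).trans_lt hT.lt_top)

/-- Once one step of a trajectory adds no length, no later step does. -/
theorem length_trajectory_le_of_succ_le {φ : Module.End R M} {F : Submodule R M}
    (hfin : i (ModuleCat.of R F) < ∞) {n : ℕ}
    (h : i (ModuleCat.of R (trajectory φ F (n + 1))) ≤ i (ModuleCat.of R (trajectory φ F n)))
    (m : ℕ) :
    i (ModuleCat.of R (trajectory φ F m)) ≤ i (ModuleCat.of R (trajectory φ F n)) := by
  have key : ∀ k, i (ModuleCat.of R (trajectory φ F (n + k + 1))) ≤
      i (ModuleCat.of R (trajectory φ F (n + k))) := by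
    intro k
    induction k with
    | zero => exact h
    | succ k ih =>
      have hT := (trajectory_ne_top i φ F hfin (n + k + 1)).lt_top
      have hm := trajectory_monotone φ F (Nat.le_succ (n + k))
      have h' := IsAdditiveInvariant.sup_le_sup_left (Submodule.map_mono hm) F
        (IsAdditiveInvariant.map_le_map φ hm ih hT)
        ((IsAdditiveInvariant.map_le i φ _).trans_lt hT)
      rwa [sup_comm, sup_comm _ F, ← trajectory_succ, ← trajectory_succ] at h'
  have key' : ∀ k, i (ModuleCat.of R (trajectory φ F (n + k))) ≤
      i (ModuleCat.of R (trajectory φ F n)) := by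
    intro k
    induction k with
    | zero => exact le_rfl
    | succ k ih => exact (key k).trans ih
  exact (IsAdditiveInvariant.mono i
    (trajectory_monotone φ F (Nat.le_add_left m n))).trans (key' m)

end Trajectory

/-! ### Trajectories of bounded length -/

/-- The trajectories of `F` under `φ` have bounded finite lengths. For a length function this
says that the smallest `φ`-invariant submodule containing `F` has finite length. -/
def HasBoundedTrajectory (i : ModuleCat.{v} R → ℝ≥0∞) {M : Type v} [AddCommGroup M] [Module R M]
    (φ : Module.End R M) (F : Submodule R M) : Prop :=
  ∃ c : ℝ≥0∞, c < ∞ ∧ ∀ n, i (ModuleCat.of R (trajectory φ F n)) ≤ c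

section Bounded

variable {M N : Type v} [AddCommGroup M] [Module R M] [AddCommGroup N] [Module R N]
variable {i : ModuleCat.{v} R → ℝ≥0∞} [IsAdditiveInvariant i]
variable {φ : Module.End R M} {ψ : Module.End R N} {f : M →ₗ[R] N}

theorem HasBoundedTrajectory.mono {F G : Submodule R M} (hG : HasBoundedTrajectory i φ G)
    (h : F ≤ G) : HasBoundedTrajectory i φ F := by
  obtain ⟨c, hc, hn⟩ := hG
  exact ⟨c, hc, fun n => (IsAdditiveInvariant.mono i (trajectory_mono φ h n)).trans (hn n)⟩

theorem HasBoundedTrajectory.sup {F G : Submodule R M} (hF : HasBoundedTrajectory i φ F)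
    (hG : HasBoundedTrajectory i φ G) : HasBoundedTrajectory i φ (F ⊔ G) := by
  obtain ⟨c, hc, hcn⟩ := hF
  obtain ⟨d, hd, hdn⟩ := hG
  refine ⟨c + d, ENNReal.add_lt_top.2 ⟨hc, hd⟩, fun n => ?_⟩
  rw [trajectory_sup]
  exact (IsAdditiveInvariant.sup_le i _ _).trans (add_le_add (hcn n) (hdn n))

theorem HasBoundedTrajectory.map {F : Submodule R M} (hF : HasBoundedTrajectory i φ F)
    (hf : ∀ x, f (φ x) = ψ (f x)) : HasBoundedTrajectory i ψ (F.map f) := by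
  obtain ⟨c, hc, hn⟩ := hF
  refine ⟨c, hc, fun n => ?_⟩
  rw [← map_trajectory hf]
  exact (IsAdditiveInvariant.map_le i f _).trans (hn n)

theorem HasBoundedTrajectory.of_map {F : Submodule R M}
    (hF : HasBoundedTrajectory i ψ (F.map f)) (hf : ∀ x, f (φ x) = ψ (f x))
    (hinj : Function.Injective f) : HasBoundedTrajectory i φ F := by
  obtain ⟨c, hc, hn⟩ := hF
  refine ⟨c, hc, fun n => ?_⟩
  rw [← IsAdditiveInvariant.map_eq_of_injective i f hinj, map_trajectory hf]
  exact hn n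

variable (i) in
theorem length_bot (M : Type v) [AddCommGroup M] [Module R M] :
    i (ModuleCat.of R (⊥ : Submodule R M)) = 0 :=
  IsObjectInvariant.eq_zero_of_isZero _ (ModuleCat.isZero_of_subsingleton _)

theorem hasBoundedTrajectory_bot : HasBoundedTrajectory i φ ⊥ :=
  ⟨0, ENNReal.zero_lt_top, fun n => by
    rw [le_bot_iff.1 (trajectory_le le_rfl bot_le n), length_bot i]⟩

variable (i φ) in
/-- The `φ`-invariant submodule of those `x` that generate bounded trajectories. -/
def boundedPart : Submodule R M where
  carrier := {x | HasBoundedTrajectory i φ (Submodule.span R {x})}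
  zero_mem' := by
    rw [Set.mem_ofPred_eq, Submodule.span_zero_singleton]
    exact hasBoundedTrajectory_bot
  add_mem' := by
    intro a b ha hb
    refine (HasBoundedTrajectory.sup ha hb).mono ?_
    rw [Submodule.span_singleton_le_iff_mem]
    exact Submodule.add_mem_sup (Submodule.mem_span_singleton_self a)
      (Submodule.mem_span_singleton_self b)
  smul_mem' r x hx := HasBoundedTrajectory.mono hx (Submodule.span_singleton_smul_le R r x)

theorem mem_boundedPart {x : M} :
    x ∈ boundedPart i φ ↔ HasBoundedTrajectory i φ (Submodule.span R {x}) := Iff.rfl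

theorem map_mem_boundedPart (hf : ∀ x, f (φ x) = ψ (f x)) {x : M} (hx : x ∈ boundedPart i φ) :
    f x ∈ boundedPart i ψ := by
  have h := HasBoundedTrajectory.map hx hf
  rwa [Submodule.map_span, Set.image_singleton] at h

theorem mem_boundedPart_of_map_mem (hf : ∀ x, f (φ x) = ψ (f x)) (hinj : Function.Injective f)
    {x : M} (hx : f x ∈ boundedPart i ψ) : x ∈ boundedPart i φ := by
  refine HasBoundedTrajectory.of_map ?_ hf hinj
  rwa [Submodule.map_span, Set.image_singleton]

theorem hasBoundedTrajectory_of_fg {F : Submodule R M} (hF : F.FG) (h : F ≤ boundedPart i φ) :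
    HasBoundedTrajectory i φ F := by
  induction F, hF using Submodule.fg_induction with
  | singleton x => exact h (Submodule.mem_span_singleton_self x)
  | sup F G _ _ hF hG =>
    exact (hF (le_sup_left.trans h)).sup (hG (le_sup_right.trans h))

theorem HasBoundedTrajectory.entropyAt_eq_zero {F : Submodule R M}
    (hF : HasBoundedTrajectory i φ F) (hfin : i (ModuleCat.of R F) < ∞) :
    entropyAt i φ F = 0 := by
  obtain ⟨c, hc, hn⟩ := hF
  refine tendsto_nhds_unique (tendsto_entropyAt i φ F hfin).1 ?_
  have h : Tendsto (fun n : ℕ => c / (n : ℝ≥0∞)) atTop (𝓝 0) := by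
    simpa using ENNReal.Tendsto.const_div (a := c) ENNReal.tendsto_nat_nhds_top
      (Or.inr hc.ne)
  exact tendsto_of_tendsto_of_tendsto_of_le_of_le tendsto_const_nhds h (fun _ => bot_le)
    fun n => ENNReal.div_le_div_right (hn n) _

end Bounded

/-! ### Discreteness and upper continuity -/

/-- `ε` is smaller than or equal to every nonzero value of `i`. -/
def IsLengthGap (i : ModuleCat.{v} R → ℝ≥0∞) (ε : ℝ≥0∞) : Prop :=
  ∀ M : ModuleCat.{v} R, i M < ε → i M = 0

/-- A set order-isomorphic to `ℕ` is well-ordered, so the positive finite values have a smallest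
possible one. -/
theorem IsDiscreteInvariant.exists_isLengthGap {i : ModuleCat.{v} R → ℝ≥0∞}
    (hi : IsDiscreteInvariant i) : ∃ ε : ℝ≥0∞, 0 < ε ∧ IsLengthGap i ε := by
  obtain ⟨S, ⟨e⟩, hS⟩ := hi
  by_cases hne : {s : S | 0 < (s : ℝ≥0)}.Nonempty
  · have hwf : WellFounded ((· < ·) : S → S → Prop) := by
      refine Subrelation.wf (r := InvImage (· < ·) e) ?_ (InvImage.wf e wellFounded_lt)
      exact fun h => e.lt_iff_lt.2 h
    refine ⟨(hwf.min _ hne : S), ?_, fun M hM => ?_⟩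
    · exact ENNReal.coe_pos.2 (hwf.min_mem _ hne)
    · obtain ⟨s, hs, hMs⟩ := hS M (hM.trans ENNReal.coe_lt_top).ne
      by_contra h0
      rw [hMs, ENNReal.coe_lt_coe] at hM
      refine hwf.not_lt_min _ (x := ⟨s, hs⟩) ?_ hM
      rw [hMs] at h0
      exact pos_iff_ne_zero.2 (by simpa using h0)
  · refine ⟨1, one_pos, fun M hM => ?_⟩
    obtain ⟨s, hs, hMs⟩ := hS M (hM.trans ENNReal.one_lt_top).ne
    by_contra h0
    rw [hMs] at h0
    exact hne ⟨⟨s, hs⟩, pos_iff_ne_zero.2 (by simpa using h0)⟩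

section Gap

variable {M N : Type v} [AddCommGroup M] [Module R M] [AddCommGroup N] [Module R N]
variable {i : ModuleCat.{v} R → ℝ≥0∞}
variable {φ : Module.End R M} {ψ : Module.End R N} {f : M →ₗ[R] N} {ε : ℝ≥0∞}

theorem IsLengthGap.add_le [IsAdditiveInvariant i] (hε : IsLengthGap i ε) {A B : Submodule R M}
    (h : A ≤ B) (hlt : i (ModuleCat.of R A) < i (ModuleCat.of R B)) :
    i (ModuleCat.of R A) + ε ≤ i (ModuleCat.of R B) := by
  have h₁ := IsAdditiveInvariant.eq_inf_ker_add_map i A.mkQ B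
  rw [Submodule.ker_mkQ, inf_eq_right.2 h] at h₁
  rw [h₁]
  refine add_le_add_right (not_lt.1 fun h₂ => hlt.ne ?_) _
  rw [h₁, hε _ h₂, add_zero]

/-- If every step of the trajectory adds length, each adds at least `ε`, whence
`H_i(φ, F) ≥ ε`. -/
theorem exists_length_trajectory_succ_le [IsAdditiveInvariant i] (hε : IsLengthGap i ε)
    (hε₀ : 0 < ε) {F : Submodule R M} (hfin : i (ModuleCat.of R F) < ∞)
    (h : entropyAt i φ F = 0) :
    ∃ n, i (ModuleCat.of R (trajectory φ F (n + 1))) ≤ i (ModuleCat.of R (trajectory φ F n)) := by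
  by_contra! hlt
  have hle : ∀ n : ℕ, (n : ℝ≥0∞) * ε ≤ i (ModuleCat.of R (trajectory φ F n)) := by
    intro n
    induction n with
    | zero => simp
    | succ n ih =>
      rw [Nat.cast_succ, add_mul, one_mul]
      exact (add_le_add_left ih ε).trans
        (hε.add_le (trajectory_monotone φ F n.le_succ) (hlt n))
  have hlim := (tendsto_entropyAt i φ F hfin).1
  rw [h] at hlim
  refine hε₀.not_ge (ge_of_tendsto hlim ?_)
  filter_upwards [eventually_gt_atTop 0] with n hn
  rw [ENNReal.le_div_iff_mul_le (Or.inl (by exact_mod_cast hn.ne'))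
    (Or.inl (ENNReal.natCast_ne_top n)), mul_comm]
  exact hle n

theorem entropyAt_eq_zero_iff [IsAdditiveInvariant i] (hε : IsLengthGap i ε) (hε₀ : 0 < ε)
    {F : Submodule R M} (hfin : i (ModuleCat.of R F) < ∞) :
    entropyAt i φ F = 0 ↔ HasBoundedTrajectory i φ F := by
  refine ⟨fun h => ?_, fun h => h.entropyAt_eq_zero hfin⟩
  obtain ⟨n, hn⟩ := exists_length_trajectory_succ_le hε hε₀ hfin h
  exact ⟨_, (trajectory_ne_top i φ F hfin n).lt_top, length_trajectory_le_of_succ_le hfin hn⟩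

variable [IsLengthFunction i]

variable (i) in
theorem length_eq_iSup_fg (P : Submodule R M) :
    i (ModuleCat.of R P) =
      ⨆ (F : Submodule R M) (_ : F ≤ P ∧ F.FG), i (ModuleCat.of R F) := by
  refine le_antisymm ?_ (iSup₂_le fun F hF => IsAdditiveInvariant.mono i hF.1)
  rw [IsLengthFunction.upperContinuous (i := i) (ModuleCat.of R P)]
  refine iSup₂_le fun F hF => ?_
  refine le_trans ?_ (le_iSup₂ (F.map P.subtype) ⟨Submodule.map_subtype_le P F, hF.map _⟩)
  exact (IsAdditiveInvariant.map_eq_of_injective i P.subtype P.injective_subtype F).ge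

theorem length_iSup_le {A : ℕ → Submodule R M} (hA : Monotone A) {c : ℝ≥0∞}
    (hc : ∀ n, i (ModuleCat.of R (A n)) ≤ c) :
    i (ModuleCat.of R (⨆ n, A n : Submodule R M)) ≤ c := by
  rw [length_eq_iSup_fg i]
  refine iSup₂_le fun F hF => ?_
  obtain ⟨n, hn⟩ := (CompleteLattice.isCompactElement_iff_le_of_directed_sSup_le _ F).1
    ((Submodule.fg_iff_compact F).1 hF.2) (Set.range A) (Set.range_nonempty A)
    hA.directed_le.directedOn_range hF.1
  obtain ⟨⟨m, rfl⟩, hn⟩ := hn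
  exact (IsAdditiveInvariant.mono i hn).trans (hc m)

/-- By upper continuity some finitely generated `G ≤ F` has length within `ε` of that of `F`,
hence the same length. -/
theorem exists_fg_length_le (hε : IsLengthGap i ε) (hε₀ : 0 < ε) {F : Submodule R M}
    (hfin : i (ModuleCat.of R F) < ∞) :
    ∃ G ≤ F, G.FG ∧ i (ModuleCat.of R F) ≤ i (ModuleCat.of R G) := by
  by_contra! h
  have hle : i (ModuleCat.of R F) + ε ≤ i (ModuleCat.of R F) := by
    have hne : Nonempty {G : Submodule R M // G ≤ F ∧ G.FG} :=
      ⟨⟨⊥, bot_le, Submodule.fg_bot⟩⟩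
    conv_lhs => rw [length_eq_iSup_fg i, iSup_subtype', ENNReal.iSup_add]
    exact iSup_le fun G => hε.add_le G.2.1 (h G G.2.1 G.2.2)
  have h₂ := (ENNReal.add_le_add_iff_left hfin.ne).1 (hle.trans (add_zero _).ge)
  exact hε₀.not_ge h₂

/-- Over a locally finite module, vanishing of the entropy can be tested on cyclic submodules:
up to a part of length zero, a submodule of finite length is finitely generated. -/
theorem iEntropy_eq_zero_iff (hε : IsLengthGap i ε) (hε₀ : 0 < ε)
    (hM : locallyFinite i (ModuleCat.of R M)) :
    iEntropy i φ = 0 ↔ ∀ x, x ∈ boundedPart i φ := by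
  simp only [iEntropy, ENNReal.iSup_eq_zero]
  refine ⟨fun h x => (entropyAt_eq_zero_iff hε hε₀ (hM x)).1 (h _ (hM x)), fun h F hF => ?_⟩
  obtain ⟨G, hGF, hG, hle⟩ := exists_fg_length_le hε hε₀ hF
  obtain ⟨c, hc, hn⟩ := hasBoundedTrajectory_of_fg hG fun x _ => h x
  exact HasBoundedTrajectory.entropyAt_eq_zero
    ⟨c, hc, fun n => (length_trajectory_le_of_le hGF hle hF n).trans (hn n)⟩ hF

/-- Bounded trajectories pass to extensions. Let `T n` be the trajectory of `Rx` and choose `n`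
such that `f (T (n + 1))` and `f (T n)` have the same length. The invariant submodule `P`
generated by `T (n + 1) ⊓ ker f` has finite length, and modulo `P` the trajectory of `x` stops
growing at step `n`. -/
theorem mem_boundedPart_of_extension (hε : IsLengthGap i ε) (hε₀ : 0 < ε)
    (hf : ∀ x, f (φ x) = ψ (f x)) (hM : locallyFinite i (ModuleCat.of R M))
    (hker : ∀ F ≤ LinearMap.ker f, i (ModuleCat.of R F) < ∞ → HasBoundedTrajectory i φ F)
    {x : M} (hx : f x ∈ boundedPart i ψ) : x ∈ boundedPart i φ := by
  set X := Submodule.span R {x} with hX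
  have hXfin : i (ModuleCat.of R X) < ∞ := hM x
  have hfXfin : i (ModuleCat.of R (X.map f)) < ∞ :=
    (IsAdditiveInvariant.map_le i f X).trans_lt hXfin
  have hfX : HasBoundedTrajectory i ψ (X.map f) := by
    rwa [hX, Submodule.map_span, Set.image_singleton]
  obtain ⟨n, hn⟩ := exists_length_trajectory_succ_le hε hε₀ hfXfin
    (hfX.entropyAt_eq_zero hfXfin)
  rw [← map_trajectory hf, ← map_trajectory hf] at hn
  set F := trajectory φ X (n + 1) ⊓ LinearMap.ker f with hF
  have hFfin : i (ModuleCat.of R F) < ∞ :=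
    (IsAdditiveInvariant.mono i inf_le_left).trans_lt
      (trajectory_ne_top i φ X hXfin (n + 1)).lt_top
  obtain ⟨c, hc, hcn⟩ := hker F inf_le_right hFfin
  set P := ⨆ k, trajectory φ F k with hP
  have hPc : i (ModuleCat.of R P) ≤ c := length_iSup_le (trajectory_monotone φ F) hcn
  have hkerf : LinearMap.ker f ≤ (LinearMap.ker f).comap φ := by
    intro y hy
    rw [Submodule.mem_comap, LinearMap.mem_ker, hf, LinearMap.mem_ker.1 hy, map_zero]
  have hPker : P ≤ LinearMap.ker f := iSup_le fun k => trajectory_le inf_le_right hkerf k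
  have hPφ : P ≤ P.comap φ := iSup_trajectory_le_comap φ F
  let φ' : Module.End R (M ⧸ P) := P.mapQ P φ hPφ
  have hφ' : ∀ y, P.mkQ (φ y) = φ' (P.mkQ y) := fun y => rfl
  have hX'fin : i (ModuleCat.of R (X.map P.mkQ)) < ∞ :=
    (IsAdditiveInvariant.map_le i P.mkQ X).trans_lt hXfin
  have hle : i (ModuleCat.of R (trajectory φ' (X.map P.mkQ) (n + 1))) ≤
      i (ModuleCat.of R (trajectory φ' (X.map P.mkQ) n)) := by
    rw [← map_trajectory hφ', ← map_trajectory hφ']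
    have hT := trajectory_ne_top i φ X hXfin (n + 1)
    -- `T (n + 1)` meets `P` and `ker f` in the same submodule, so its images have equal length.
    have hinf : trajectory φ X (n + 1) ⊓ P = F :=
      le_antisymm (inf_le_inf_left _ hPker) (le_inf inf_le_left (le_iSup_trajectory φ F))
    have h₁ := IsAdditiveInvariant.eq_inf_ker_add_map i P.mkQ (trajectory φ X (n + 1))
    have h₂ := IsAdditiveInvariant.eq_inf_ker_add_map i f (trajectory φ X (n + 1))
    rw [Submodule.ker_mkQ, hinf, h₂] at h₁
    have h₃ := (ENNReal.add_right_inj hFfin.ne).1 h₁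
    have h₄ : i (ModuleCat.of R ((trajectory φ X n).map f)) ≤
        i (ModuleCat.of R ((trajectory φ X n).map P.mkQ)) := by
      have hcomp : P.liftQ f hPker ∘ₗ P.mkQ = f := P.liftQ_mkQ f hPker
      conv_lhs => rw [← hcomp, Submodule.map_comp]
      exact IsAdditiveInvariant.map_le i _ _
    exact h₃.ge.trans (hn.trans h₄)
  refine ⟨c + i (ModuleCat.of R (trajectory φ' (X.map P.mkQ) n)), ENNReal.add_lt_top.2
    ⟨hc, (trajectory_ne_top i φ' _ hX'fin n).lt_top⟩, fun m => ?_⟩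
  rw [IsAdditiveInvariant.eq_inf_ker_add_map i P.mkQ (trajectory φ X m), Submodule.ker_mkQ,
    map_trajectory hφ']
  exact add_le_add ((IsAdditiveInvariant.mono i inf_le_right).trans hPc)
    (length_trajectory_le_of_succ_le hX'fin hle m)

end Gap

theorem iEntropy_le_of_injective {M N : Type v} [AddCommGroup M] [Module R M] [AddCommGroup N]
    [Module R N] {i : ModuleCat.{v} R → ℝ≥0∞} [IsAdditiveInvariant i] {φ : Module.End R M}
    {ψ : Module.End R N} {f : M →ₗ[R] N} (hf : ∀ x, f (φ x) = ψ (f x))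
    (hinj : Function.Injective f) : iEntropy i φ ≤ iEntropy i ψ := by
  refine iSup₂_le fun F hF => ?_
  have h : entropyAt i φ F = entropyAt i ψ (F.map f) := by
    unfold entropyAt
    congr 1
    funext n
    rw [← map_trajectory hf, IsAdditiveInvariant.map_eq_of_injective i f hinj]
  rw [h]
  exact le_iSup₂ (f := fun (G : Submodule R N) (_ : i (ModuleCat.of R G) < ∞) =>
    entropyAt i ψ G) (F.map f) ((IsAdditiveInvariant.map_le i f F).trans_lt hF)

end Modules

/-! ### Subflows and quotient flows -/

section Flows

variable {R : Type u} [Ring R] {i : ModuleCat.{v} R → ℝ≥0∞}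

namespace FlowCat

/-- The linear endomorphism of the underlying module of a flow of modules. -/
abbrev linearEndo (X : FlowCat (locallyFinite i).FullSubcategory) : Module.End R X.obj.obj :=
  X.endo.hom.hom

/-- The linear map underlying a morphism of flows of modules. -/
abbrev Hom.linear {X Y : FlowCat (locallyFinite i).FullSubcategory} (f : X ⟶ Y) :
    X.obj.obj →ₗ[R] Y.obj.obj :=
  f.hom.hom.hom

variable {X Y : FlowCat (locallyFinite i).FullSubcategory}

theorem linear_comm (f : X ⟶ Y) (x : X.obj.obj) :
    Hom.linear f (X.linearEndo x) = Y.linearEndo (Hom.linear f x) :=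
  congrArg (fun g => g.hom.hom x) f.comm

theorem linear_zero_apply (x : X.obj.obj) : Hom.linear (0 : X ⟶ Y) x = 0 := rfl

theorem linear_ext {f g : X ⟶ Y} (h : ∀ x, Hom.linear f x = Hom.linear g x) : f = g :=
  hom_ext (ObjectProperty.hom_ext _ (ModuleCat.hom_ext (LinearMap.ext h)))

theorem ker_le_comap (f : X ⟶ Y) :
    LinearMap.ker (Hom.linear f) ≤ (LinearMap.ker (Hom.linear f)).comap X.linearEndo := by
  intro x hx
  rw [Submodule.mem_comap, LinearMap.mem_ker, linear_comm, LinearMap.mem_ker.1 hx, map_zero]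

theorem range_le_comap (f : X ⟶ Y) :
    LinearMap.range (Hom.linear f) ≤ (LinearMap.range (Hom.linear f)).comap Y.linearEndo := by
  rintro _ ⟨x, rfl⟩
  exact ⟨X.linearEndo x, linear_comm f x⟩

variable [IsAdditiveInvariant i]

/-- The subflow on an invariant submodule. -/
def sub (X : FlowCat (locallyFinite i).FullSubcategory) (P : Submodule R X.obj.obj)
    (hP : P ≤ P.comap X.linearEndo) : FlowCat (locallyFinite i).FullSubcategory where
  obj := ⟨ModuleCat.of R P, by
    have : Mono (ModuleCat.ofHom P.subtype) :=
      (ModuleCat.mono_iff_injective _).2 P.injective_subtype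
    exact (locallyFinite i).prop_of_mono (ModuleCat.ofHom P.subtype) X.obj.property⟩
  endo := ObjectProperty.homMk (ModuleCat.ofHom (X.linearEndo.restrict hP))

/-- The inclusion of a subflow. -/
def subι (X : FlowCat (locallyFinite i).FullSubcategory) (P : Submodule R X.obj.obj)
    (hP : P ≤ P.comap X.linearEndo) : X.sub P hP ⟶ X where
  hom := ObjectProperty.homMk (ModuleCat.ofHom P.subtype)
  comm := rfl

/-- The quotient flow modulo an invariant submodule. -/
def quot (X : FlowCat (locallyFinite i).FullSubcategory) (P : Submodule R X.obj.obj)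
    (hP : P ≤ P.comap X.linearEndo) : FlowCat (locallyFinite i).FullSubcategory where
  obj := ⟨ModuleCat.of R (X.obj.obj ⧸ P), by
    have : Epi (ModuleCat.ofHom P.mkQ) :=
      (ModuleCat.epi_iff_surjective _).2 P.mkQ_surjective
    exact (locallyFinite i).prop_of_epi (ModuleCat.ofHom P.mkQ) X.obj.property⟩
  endo := ObjectProperty.homMk (ModuleCat.ofHom (P.mapQ P X.linearEndo hP))

/-- The projection onto a quotient flow. -/
def quotπ (X : FlowCat (locallyFinite i).FullSubcategory) (P : Submodule R X.obj.obj)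
    (hP : P ≤ P.comap X.linearEndo) : X ⟶ X.quot P hP where
  hom := ObjectProperty.homMk (ModuleCat.ofHom P.mkQ)
  comm := rfl

theorem mem_of_quotπ_eq_zero {P : Submodule R X.obj.obj} {hP : P ≤ P.comap X.linearEndo}
    (h : X.quotπ P hP = 0) (x : X.obj.obj) : x ∈ P := by
  have hx : Hom.linear (X.quotπ P hP) x = 0 := by rw [h, linear_zero_apply]
  exact (Submodule.Quotient.mk_eq_zero P).1 hx

theorem subι_ker_comp (f : X ⟶ Y) :
    X.subι (LinearMap.ker (Hom.linear f)) (ker_le_comap f) ≫ f = 0 :=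
  linear_ext fun x => LinearMap.mem_ker.1 x.2

theorem linear_injective (f : X ⟶ Y) [Mono f] : Function.Injective (Hom.linear f) := by
  rw [← LinearMap.ker_eq_bot, eq_bot_iff]
  intro x hx
  have h : X.subι _ (ker_le_comap f) = 0 := by
    rw [← cancel_mono f, subι_ker_comp, zero_comp]
  let x' : LinearMap.ker (Hom.linear f) := ⟨x, hx⟩
  exact congrArg (fun g : X.sub _ (ker_le_comap f) ⟶ X => Hom.linear g x') h

theorem linear_surjective (f : X ⟶ Y) [Epi f] : Function.Surjective (Hom.linear f) := by
  intro y
  have h : Y.quotπ _ (range_le_comap f) = 0 := by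
    rw [← cancel_epi f, comp_zero]
    exact linear_ext fun x => (Submodule.Quotient.mk_eq_zero _).2 ⟨x, rfl⟩
  exact mem_of_quotπ_eq_zero h y

end FlowCat

/-! ### Vanishing of the entropy of a flow -/

open FlowCat

variable [IsAdditiveInvariant i]

theorem iEntropyFlow_eq_of_iso {X Y : FlowCat (locallyFinite i).FullSubcategory} (e : X ≅ Y) :
    iEntropyFlow i X = iEntropyFlow i Y :=
  le_antisymm (iEntropy_le_of_injective (linear_comm e.hom) (linear_injective e.hom))
    (iEntropy_le_of_injective (linear_comm e.inv) (linear_injective e.inv))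

end Flows

section Vanishing

open FlowCat

variable {R : Type u} [Ring R] {i : ModuleCat.{v} R → ℝ≥0∞} [IsLengthFunction i] {ε : ℝ≥0∞}

theorem iEntropyFlow_eq_zero_iff (hε : IsLengthGap i ε) (hε₀ : 0 < ε)
    (X : FlowCat (locallyFinite i).FullSubcategory) :
    iEntropyFlow i X = 0 ↔ ∀ x, x ∈ boundedPart i X.linearEndo :=
  iEntropy_eq_zero_iff hε hε₀ X.obj.property

theorem iEntropyFlow_eq_zero_of_mono (hε : IsLengthGap i ε) (hε₀ : 0 < ε)
    {X Y : FlowCat (locallyFinite i).FullSubcategory} (f : X ⟶ Y) [Mono f]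
    (hY : iEntropyFlow i Y = 0) : iEntropyFlow i X = 0 := by
  rw [iEntropyFlow_eq_zero_iff hε hε₀] at hY ⊢
  exact fun x => mem_boundedPart_of_map_mem (linear_comm f) (linear_injective f) (hY _)

theorem iEntropyFlow_eq_zero_of_epi (hε : IsLengthGap i ε) (hε₀ : 0 < ε)
    {X Y : FlowCat (locallyFinite i).FullSubcategory} (f : X ⟶ Y) [Epi f]
    (hX : iEntropyFlow i X = 0) : iEntropyFlow i Y = 0 := by
  rw [iEntropyFlow_eq_zero_iff hε hε₀] at hX ⊢
  intro y
  obtain ⟨x, rfl⟩ := linear_surjective f y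
  exact map_mem_boundedPart (linear_comm f) (hX x)

theorem iEntropyFlow_eq_zero_of_shortExact (hε : IsLengthGap i ε) (hε₀ : 0 < ε)
    {S : ShortComplex (FlowCat (locallyFinite i).FullSubcategory)} (hS : S.ShortExact)
    (h₁ : iEntropyFlow i S.X₁ = 0) (h₃ : iEntropyFlow i S.X₃ = 0) : iEntropyFlow i S.X₂ = 0 := by
  rw [iEntropyFlow_eq_zero_iff hε hε₀] at h₃ ⊢
  have hkf := ker_le_comap S.g
  have := hS.mono_f
  -- The subflow on `ker g` factors through `X₁`, and so has entropy zero.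
  obtain ⟨l, hl⟩ : ∃ l, l ≫ S.f = S.X₂.subι _ hkf :=
    ⟨_, hS.exact.lift_f _ (subι_ker_comp S.g)⟩
  have hι : Function.Injective (Hom.linear (S.X₂.subι _ hkf)) :=
    (LinearMap.ker (Hom.linear S.g)).injective_subtype
  have hl' : Function.Injective (Hom.linear l) := by
    rw [← hl] at hι
    exact Function.Injective.of_comp (f := Hom.linear S.f) hι
  have h₀ : iEntropy i (S.X₂.sub _ hkf).linearEndo = 0 :=
    le_bot_iff.1 ((iEntropy_le_of_injective (linear_comm l) hl').trans h₁.le)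
  simp only [iEntropy, ENNReal.iSup_eq_zero] at h₀
  refine fun x => mem_boundedPart_of_extension hε hε₀ (linear_comm S.g) S.X₂.obj.property
    (fun F hF hfin => ?_) (h₃ _)
  have hmap : (F.comap (LinearMap.ker (Hom.linear S.g)).subtype).map
      (LinearMap.ker (Hom.linear S.g)).subtype = F := by
    rw [Submodule.map_comap_subtype, inf_eq_right.2 hF]
  have hfin' : i (ModuleCat.of R
      (F.comap (LinearMap.ker (Hom.linear S.g)).subtype)) < ∞ := by
    rwa [← IsAdditiveInvariant.map_eq_of_injective i _
      (LinearMap.ker (Hom.linear S.g)).injective_subtype, hmap]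
  have hb := ((entropyAt_eq_zero_iff hε hε₀ hfin').1 (h₀ _ hfin')).map
    (linear_comm (S.X₂.subι _ hkf))
  exact hmap ▸ hb

/-- The bounded part of `Y` is a subflow containing the images of all `X j`, so it is `Y`. -/
theorem iEntropyFlow_eq_zero_of_jointly_epi (hε : IsLengthGap i ε) (hε₀ : 0 < ε) {J : Type*}
    {X : J → FlowCat (locallyFinite i).FullSubcategory}
    {Y : FlowCat (locallyFinite i).FullSubcategory} (f : ∀ j, X j ⟶ Y)
    (hf : ∀ {Z : FlowCat (locallyFinite i).FullSubcategory} (g : Y ⟶ Z),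
      (∀ j, f j ≫ g = 0) → g = 0)
    (h : ∀ j, iEntropyFlow i (X j) = 0) : iEntropyFlow i Y = 0 := by
  rw [iEntropyFlow_eq_zero_iff hε hε₀]
  have hP : boundedPart i Y.linearEndo ≤ (boundedPart i Y.linearEndo).comap Y.linearEndo :=
    fun x hx => map_mem_boundedPart (f := Y.linearEndo) (fun _ => rfl) hx
  -- The quotient by the bounded part kills the image of every `X j`.
  have hq : Y.quotπ _ hP = 0 := by
    refine hf _ fun j => linear_ext fun x => ?_
    have hx : x ∈ boundedPart i (X j).linearEndo :=
      (iEntropyFlow_eq_zero_iff hε hε₀ (X j)).1 (h j) x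
    have hy : Hom.linear (f j) x ∈ boundedPart i Y.linearEndo :=
      map_mem_boundedPart (linear_comm (f j)) hx
    exact (Submodule.Quotient.mk_eq_zero (boundedPart i Y.linearEndo)).2 hy
  exact fun x => mem_of_quotπ_eq_zero hq x

end Vanishing

theorem theorem5p13 {R : Type u} [Ring R] (i : ModuleCat.{v} R → ℝ≥0∞) [IsLengthFunction i]
    (hi : IsDiscreteInvariant i) : IsEntropyFunction (iEntropyFlow i) := by
  obtain ⟨ε, hε₀, hε⟩ := hi.exists_isLengthGap
  refine ⟨⟨fun X hX => ?_, iEntropyFlow_eq_of_iso⟩, fun S hS => ⟨fun h => ?_, fun h => ?_⟩,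
    fun {J} X => ⟨fun h j => ?_, fun h => ?_⟩⟩
  · rw [iEntropyFlow_eq_zero_iff hε hε₀]
    intro x
    have hx : x = 0 := congrArg (fun g => FlowCat.Hom.linear g x) (hX.eq_of_src (𝟙 X) 0)
    exact hx ▸ Submodule.zero_mem _
  · have := hS.mono_f
    have := hS.epi_g
    exact ⟨iEntropyFlow_eq_zero_of_mono hε hε₀ S.f h, iEntropyFlow_eq_zero_of_epi hε hε₀ S.g h⟩
  · exact iEntropyFlow_eq_zero_of_shortExact hε hε₀ hS h.1 h.2
  · exact iEntropyFlow_eq_zero_of_mono hε hε₀ (Sigma.ι X j) h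
  · refine iEntropyFlow_eq_zero_of_jointly_epi hε hε₀ (Sigma.ι X) (fun g hg => ?_) h
    exact Sigma.hom_ext _ _ fun j => by rw [hg j, comp_zero]
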